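/- Conventions. A $(\lambda,k)$-quasi-geodesic segment in a metric space $X$ is a map $\gamma\colon[0,a]\to X$ with $\lambda^{-1}|t-s|-k\le d(\gamma(t),\gamma(s))\le\lambda|t-s|+k$ for all $s,t\in[0,a]$. Let $\lambda\ge1$, $k\ge0$, $E\ge1$, $C\ge0$ be constants, $\theta\colon\mathbb R_{\ge0}\to\mathbb R_{\ge0}$ a non-decreasing function and $\mathcal L$ a family of $(\lambda,k)$-quasi-geodesic segments in $X$. The space $X$ is $(\lambda,k,E,C,\theta,\mathcal L)$-coarsely convex if (i) any $v,w\in X$ are joined by some $\gamma\in\mathcal L$, i.e. $\gamma\colon[0,a]\to X$ with $\gamma(0)=v$, $\gamma(a)=w$; and for all $\gamma,\eta\in\mathcal L$ with domains $[0,a]$, $[0,b]$ and all $t\in[0,a]$, $s\in[0,b]$, (ii) $d(\gamma(ct),\eta(cs))\le cE\,d(\gamma(t),\eta(s))+(1-c)E\,d(\gamma(0),\eta(0))+C$ for all $0\le c\le1$, and (iii) $|t-s|\le\theta\bigl(d(\gamma(0),\eta(0))+d(\gamma(t),\eta(s))\bigr)$. Let $\mathcal L^\infty$ be the set of maps $\gamma\colon\mathbb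 R_{\ge0}\to X$ with $\gamma(t)=\gamma(\lfloor t\rfloor)$ for all $t$ for which there are $\gamma_n\in\mathcal L$ with domains $[0,a_n]$, $a_n\to\infty$, $\gamma_n(0)=\gamma(0)$, converging to $\gamma$ pointwise on $\mathbb N$. The ideal boundary $\partial X$ is the quotient of $\mathcal L^\infty$ by the relation $\gamma\sim\eta\iff\sup_t d(\gamma(t),\eta(t))<\infty$; the class of $\gamma$ is $[\gamma]$. Fix a base point $O\in X$ and put $D=2(1+E)(\lambda+k)+C$. For two segments or rays put $(\gamma\mid\eta)=\sup\{t\in\operatorname{Dom}\gamma\cap\operatorname{Dom}\eta: d(\gamma(t),\eta(t))\le 2D+2\}\in[0,\infty]$. For $x,y\in X\cup\partial X$ put $(x\mid y)_O=0$ if $x$ or $y$ is a point of the closed ball $\bar B(O,2\lambda\theta(0)+k)$ in $X$, and otherwise $(x\mid y)_O=\sup(\gamma\mid\eta)$ over all $\gamma\in\bar{\mathcal L}_O(x)$, $\eta\in\bar{\mathcal L}_O(y)$. Here, for $x\in X$, $\bar{\mathcal L}_O(x)$ is the set of $\gamma\in\mathcal L$ with $\operatorname{Dom}\gamma=[0,a]$,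 $a\ge2\theta(0)$, $\gamma(0)=O$, $\gamma(a)=x$, and for $x\in\partial X$ it is the set of $\gamma\in\mathcal L^\infty$ with $\gamma(0)=O$ and $[\gamma]=x$. The set $X\cup\partial X$ carries the topology in which $U$ is open iff for every $x\in U$ there is $n\ge1$ with $V_n(x)\subset U$, where $V_n(x)=\{y:(x,y)\in V_n\}$ and $V_n=\{(x,y)\in(X\cup\partial X)^2:(x\mid y)_O>n\}\cup\{(x,y)\in X^2:d(x,y)<1/n\}$. Let $X$ and $Y$ be proper coarsely convex metric spaces (all closed bounded sets are compact), each with a fixed choice of the data above, and with base points $a\in X$, $b\in Y$. A map $f\colon X\to Y$ is visual if it is large scale Lipschitz (there are $A\ge1$, $B\ge0$ with $d(f(x),f(x'))\le A\,d(x,x')+B$ for all $x,x'\in X$) and, for all sequences $(x_n),(y_n)$ in $X$, $(x_n\mid y_n)_a\to\infty$ implies $(f(x_n)\mid f(y_n))_b\to\infty$. Proposition. Let $f\colon X\to Y$ be a visual map. Then there is a map $\partial f\colon\partial X\to\partial Y$ such that for every $x\in\partial X$ and every representative $\gamma\in\mathcal L^\infty$ of $x$, the sequence $f(\gamma(n))$,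 $n\in\mathbb N$, converges in $Y\cup\partial Y$ to $\partial f(x)$, and this is its only limit; in particular $\partial f([\gamma])=\lim_{n}f(\gamma(n))$ is well defined and does not depend on the choice of $\gamma$. Moreover, the map $f\cup\partial f\colon X\cup\partial X\to Y\cup\partial Y$ is continuous at every point of $\partial X$. -/

import Mathlib

open Filter Topology
open scoped NNReal ENNReal

noncomputable section

/-- A map into `X` with domain `[0, len]` if `len < ∞` (a segment), and with domain `ℝ≥0`
if `len = ∞` (a ray). Values of `toFun` outside the domain are never used. -/
structure Curve (X : Type*) where
  len : ℝ≥0∞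
  toFun : ℝ≥0 → X

namespace Curve

variable {X : Type*}

instance : CoeFun (Curve X) (fun _ => ℝ≥0 → X) := ⟨Curve.toFun⟩

/-- The domain of a curve. -/
def Dom (γ : Curve X) : Set ℝ≥0 := {t | (t : ℝ≥0∞) ≤ γ.len}

/-- The end point `γ(a)` of a segment `γ` with domain `[0, a]`. -/
def terminal (γ : Curve X) : X := γ γ.len.toNNReal

/-- `(lam, k)`-quasi-geodesics. -/
def IsQuasiGeodesic [MetricSpace X] (lam k : ℝ) (γ : Curve X) : Prop :=
  ∀ s ∈ γ.Dom, ∀ t ∈ γ.Dom,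
    lam⁻¹ * |(s : ℝ) - t| - k ≤ dist (γ s) (γ t) ∧ dist (γ s) (γ t) ≤ lam * |(s : ℝ) - t| + k

end Curve

/-- The constants `lam, k, E, C`, the function `θ` and the system `L` of good quasi-geodesic
segments that make `X` a `(lam, k, E, C, θ, L)`-coarsely convex space. -/
structure CoarseConvexity (X : Type*) [MetricSpace X] where
  lam : ℝ
  k : ℝ
  E : ℝ
  C : ℝ
  θ : ℝ≥0 → ℝ≥0
  L : Set (Curve X)
  one_le_lam : 1 ≤ lam
  k_nonneg : 0 ≤ k
  one_le_E : 1 ≤ E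
  C_nonneg : 0 ≤ C
  θ_mono : Monotone θ
  len_ne_top : ∀ γ ∈ L, γ.len ≠ ∞
  quasiGeodesic : ∀ γ ∈ L, γ.IsQuasiGeodesic lam k
  connected : ∀ v w : X, ∃ γ ∈ L, γ 0 = v ∧ γ.terminal = w
  convex : ∀ γ ∈ L, ∀ η ∈ L, ∀ t ∈ γ.Dom, ∀ s ∈ η.Dom, ∀ c : ℝ≥0, c ≤ 1 →
    dist (γ (c * t)) (η (c * s)) ≤
      c * E * dist (γ t) (η s) + (1 - (c : ℝ)) * E * dist (γ 0) (η 0) + C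
  param : ∀ γ ∈ L, ∀ η ∈ L, ∀ t ∈ γ.Dom, ∀ s ∈ η.Dom,
    |(t : ℝ) - s| ≤ θ (nndist (γ 0) (η 0) + nndist (γ t) (η s))

namespace CoarseConvexity

variable {X : Type*} [MetricSpace X] (S : CoarseConvexity X)

/-- The constant `k₁ = lam + k`. -/
def k₁ : ℝ := S.lam + S.k

/-- The constant `D = 2 (1 + E) k₁ + C`. -/
def D : ℝ := 2 * (1 + S.E) * S.k₁ + S.C

/-- `γ` is `L`-approximatable: there are `γₙ ∈ L` with domains `[0, aₙ]`, `aₙ → ∞`, starting at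
`γ(0)` and converging to `γ` pointwise on `ℕ`. -/
def IsApproximatable (γ : Curve X) : Prop :=
  ∃ g : ℕ → Curve X, (∀ n, g n ∈ S.L ∧ g n 0 = γ 0) ∧
    Tendsto (fun n => (g n).len) atTop (𝓝 ∞) ∧
    ∀ m : ℕ, Tendsto (fun n => g n (m : ℝ≥0)) atTop (𝓝 (γ (m : ℝ≥0)))

/-- The family `L^∞` of quasi-geodesic rays. -/
def Linf : Set (Curve X) :=
  {γ | γ.len = ∞ ∧ S.IsApproximatable γ ∧ ∀ t : ℝ≥0, γ t = γ ((⌊t⌋₊ : ℕ) : ℝ≥0)}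

/-- Two rays are equivalent if they stay at bounded distance at equal times. -/
def raySetoid : Setoid S.Linf where
  r γ η := BddAbove (Set.range fun t : ℝ≥0 => dist (γ.1 t) (η.1 t))
  iseqv :=
    { refl := fun γ => ⟨0, by rintro _ ⟨t, rfl⟩; simp⟩
      symm := by
        rintro γ η ⟨M, hM⟩
        refine ⟨M, ?_⟩
        rintro _ ⟨t, rfl⟩
        simpa [dist_comm] using hM ⟨t, rfl⟩
      trans := by
        rintro γ η ξ ⟨M, hM⟩ ⟨N, hN⟩
        refine ⟨M + N, ?_⟩
        rintro _ ⟨t, rfl⟩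
        exact (dist_triangle _ (η.1 t) _).trans (add_le_add (hM ⟨t, rfl⟩) (hN ⟨t, rfl⟩)) }

/-- The ideal boundary `∂X`, the set of equivalence classes of rays in `L^∞`. -/
def Boundary : Type _ := Quotient S.raySetoid

/-- The class `[γ] ∈ ∂X` of a ray `γ`. -/
def cls (γ : S.Linf) : S.Boundary := Quotient.mk S.raySetoid γ

/-- The set `X ∪ ∂X`. The base point `O` is only recorded for the topology. -/
inductive Bar (O : X) : Type _
  | point (x : X) : Bar O
  | ideal (ξ : S.Boundary) : Bar O

variable {S} {O : X}

/-- The product `(γ ∣ η)` of two curves. -/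
def curveProd (S : CoarseConvexity X) (γ η : Curve X) : ℝ≥0∞ :=
  sSup ((fun t : ℝ≥0 => (t : ℝ≥0∞)) ''
    {t | t ∈ γ.Dom ∩ η.Dom ∧ dist (γ t) (η t) ≤ 2 * S.D + 2})

namespace Bar

/-- `x` is a point of the closed ball of radius `2 lam θ(0) + k` about `O` in `X`. -/
def IsNear : S.Bar O → Prop
  | point x => x ∈ Metric.closedBall O (2 * S.lam * S.θ 0 + S.k)
  | ideal _ => False

/-- The good quasi-geodesics from `O` to `x`: segments in `L` of length at least `2 θ(0)` that
start at `O` and end at `x` if `x ∈ X`, and rays in `L^∞` that start at `O` and belong to the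
class `x` if `x ∈ ∂X`. -/
def curvesTo : S.Bar O → Set (Curve X)
  | point x => {γ | γ ∈ S.L ∧ ((2 * S.θ 0 : ℝ≥0) : ℝ≥0∞) ≤ γ.len ∧ γ 0 = O ∧ γ.terminal = x}
  | ideal ξ => {γ | γ 0 = O ∧ ∃ h : γ ∈ S.Linf, S.cls ⟨γ, h⟩ = ξ}

open Classical in
/-- The product `(x ∣ y)` with respect to the base point `O`, with values in `[0, ∞]`. -/
def gprod (x y : S.Bar O) : ℝ≥0∞ :=
  if x.IsNear ∨ y.IsNear then 0
  else ⨆ γ ∈ x.curvesTo, ⨆ η ∈ y.curvesTo, S.curveProd γ η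

/-- The entourage `Vₙ`. -/
def V (n : ℕ) : Set (S.Bar O × S.Bar O) :=
  {p | (n : ℝ≥0∞) < gprod p.1 p.2} ∪
  {p | ∃ x y : X, p = (point x, point y) ∧ dist x y < (n : ℝ)⁻¹}

theorem V_anti {m n : ℕ} (hm : 1 ≤ m) (h : m ≤ n) :
    (V n : Set (S.Bar O × S.Bar O)) ⊆ V m := by
  rintro p (hp | ⟨x, y, rfl, hp⟩)
  · have h' : (m : ℝ≥0∞) ≤ n := by exact_mod_cast h
    exact Or.inl (h'.trans_lt hp)
  · refine Or.inr ⟨x, y, rfl, hp.trans_le ?_⟩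
    have : (0 : ℝ) < m := by exact_mod_cast hm
    exact inv_anti₀ this (by exact_mod_cast h)

/-- The topology on `X ∪ ∂X` of the uniform structure generated by the entourages `Vₙ`, `n ≥ 1`:
`U` is open if every `x ∈ U` has some `Vₙ(x)` inside `U`. -/
instance : TopologicalSpace (S.Bar O) where
  IsOpen U := ∀ x ∈ U, ∃ n : ℕ, 1 ≤ n ∧ {y | (x, y) ∈ V n} ⊆ U
  isOpen_univ := fun _ _ => ⟨1, le_rfl, Set.subset_univ _⟩
  isOpen_inter := by
    rintro U W hU hW x ⟨hxU, hxW⟩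
    obtain ⟨m, hm, h1⟩ := hU x hxU
    obtain ⟨n, hn, h2⟩ := hW x hxW
    refine ⟨max m n, hm.trans (le_max_left _ _), fun y hy => ⟨?_, ?_⟩⟩
    · exact h1 (V_anti hm (le_max_left _ _) hy)
    · exact h2 (V_anti hn (le_max_right _ _) hy)
  isOpen_sUnion := by
    rintro 𝒰 h x ⟨U, hU, hx⟩
    obtain ⟨n, hn, hs⟩ := h U hU x hx
    exact ⟨n, hn, hs.trans (Set.subset_sUnion_of_mem hU)⟩

end Bar

end CoarseConvexity

/-- Large scale Lipschitz maps. -/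
def IsLargeScaleLipschitz {X Y : Type*} [MetricSpace X] [MetricSpace Y] (f : X → Y) : Prop :=
  ∃ A B : ℝ, 1 ≤ A ∧ 0 ≤ B ∧ ∀ x x' : X, dist (f x) (f x') ≤ A * dist x x' + B

/-- Visual maps, with respect to base points `a` and `b`. -/
def IsVisual {X Y : Type*} [MetricSpace X] [MetricSpace Y] (S : CoarseConvexity X)
    (T : CoarseConvexity Y) (a : X) (b : Y) (f : X → Y) : Prop :=
  IsLargeScaleLipschitz f ∧ ∀ x y : ℕ → X,
    Tendsto (fun n => CoarseConvexity.Bar.gprod (.point (x n) : S.Bar a) (.point (y n)))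
      atTop (𝓝 ∞) →
    Tendsto (fun n => CoarseConvexity.Bar.gprod (.point (f (x n)) : T.Bar b) (.point (f (y n))))
      atTop (𝓝 ∞)

/-- The combined map `f ∪ F : X ∪ ∂X → Y ∪ ∂Y` of `f : X → Y` and `F : ∂X → ∂Y`. -/
def combinedMap {X Y : Type*} [MetricSpace X] [MetricSpace Y] (S : CoarseConvexity X)
    (T : CoarseConvexity Y) (a : X) (b : Y) (f : X → Y) (F : S.Boundary → T.Boundary) :
    S.Bar a → T.Bar b
  | .point x => .point (f x)
  | .ideal ξ => .ideal (F ξ)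

end

/-! Coarse convexity contracts towards a common origin: if two good curves from `O` are `M`-close at
time `t`, then at time `c t`, with `c` depending only on `M`, they are within the threshold `2D +
2`. So, up to a constant factor, the product is the time during which good curves fellow-travel
(`exists_fellow_of_lt_gprod`, `exists_mul_le_gprod`). Closeness at a fixed time adds up along a
chain, and therefore the product is a quasi-ultrametric at infinity (`exists_lt_gprod_trans`).

A visual map thus carries points of `X` with large product with `ξ` to points with large mutual
product. Properness makes such sequences converge to an ideal point (`exists_ideal_of_cauchy`),
which defines the boundary map. Since the estimate holds for all points near `ξ` and not just along
one ray (`IsVisual.exists_ideal`), it gives both independence of the representative and continuity;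
ideal points near `ξ` are reached through far points of their rays. -/

theorem Curve.mem_Dom_of_le {X : Type*} {γ : Curve X} {s t : ℝ≥0} (h : s ≤ t) (ht : t ∈ γ.Dom) :
    s ∈ γ.Dom :=
  le_trans (ENNReal.coe_le_coe.2 h) ht

/-! ### Coarse convexity for segments and their limit rays -/

namespace CoarseConvexity

section Good

variable {X : Type*} [MetricSpace X] (S : CoarseConvexity X)

/-- The good segments together with the rays that they approximate. -/
def Good : Set (Curve X) := S.L ∪ S.Linf

theorem one_le_k₁ : 1 ≤ S.k₁ := by
  have := S.one_le_lam
  have := S.k_nonneg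
  unfold k₁
  linarith

theorem D_nonneg : 0 ≤ S.D := by
  have := S.one_le_k₁
  have := S.one_le_E
  have := S.C_nonneg
  unfold D
  positivity

variable {S} {γ η : Curve X}

theorem len_toNNReal_mem_Dom (hγ : γ ∈ S.L) : γ.len.toNNReal ∈ γ.Dom :=
  (ENNReal.coe_toNNReal (S.len_ne_top γ hγ)).le

theorem le_len_toNNReal (hγ : γ ∈ S.L) {t : ℝ≥0} (ht : t ∈ γ.Dom) : t ≤ γ.len.toNNReal := by
  rw [← ENNReal.coe_le_coe, ENNReal.coe_toNNReal (S.len_ne_top γ hγ)]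
  exact ht

theorem mem_Dom_of_mem_Linf (hγ : γ ∈ S.Linf) (t : ℝ≥0) : t ∈ γ.Dom := by
  change (t : ℝ≥0∞) ≤ γ.len
  rw [hγ.1]
  exact le_top

/-- A good curve is close to a good segment on every bounded part of its domain. -/
theorem exists_approx (hγ : γ ∈ S.Good) {T : ℝ≥0} (hT : T ∈ γ.Dom) :
    ∃ g ∈ S.L, g 0 = γ 0 ∧ T ∈ g.Dom ∧ ∀ t ≤ T, dist (γ t) (g t) ≤ S.k₁ + 1 := by
  rcases hγ with hγ | ⟨-, ⟨g, hg, hlen, hlim⟩, hfl⟩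
  · refine ⟨γ, hγ, rfl, hT, fun t _ => ?_⟩
    have := S.one_le_k₁
    rw [dist_self]
    linarith
  · have h1 : ∀ᶠ n in atTop, (T : ℝ≥0∞) < (g n).len :=
      hlen.eventually (lt_mem_nhds ENNReal.coe_lt_top)
    have h2 : ∀ᶠ n in atTop, ∀ m ∈ Finset.range (⌊T⌋₊ + 1),
        dist (g n (m : ℝ≥0)) (γ (m : ℝ≥0)) < 1 :=
      (Filter.eventually_all_finset _).2 fun m _ =>
        (hlim m).eventually (Metric.ball_mem_nhds _ one_pos)
    obtain ⟨n, hn1, hn2⟩ := (h1.and h2).exists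
    refine ⟨g n, (hg n).1, (hg n).2, hn1.le, fun t ht => ?_⟩
    have h3 := hn2 ⌊t⌋₊ (Finset.mem_range.2 (Nat.lt_succ_of_le (Nat.floor_mono ht)))
    have hle : ((⌊t⌋₊ : ℕ) : ℝ≥0) ≤ t := Nat.floor_le zero_le
    have h4 := (S.quasiGeodesic _ (hg n).1 _
      (Curve.mem_Dom_of_le (hle.trans ht) hn1.le) t (Curve.mem_Dom_of_le ht hn1.le)).2
    have h5 : |(((⌊t⌋₊ : ℕ) : ℝ≥0) : ℝ) - t| ≤ 1 := by
      have h6 : (((⌊t⌋₊ : ℕ) : ℝ≥0) : ℝ) ≤ t := by exact_mod_cast hle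
      have h7 : (t : ℝ) < ((⌊t⌋₊ : ℕ) : ℝ≥0) + 1 := by exact_mod_cast Nat.lt_floor_add_one t
      rw [abs_le]
      constructor <;> linarith
    have h8 : S.lam * |(((⌊t⌋₊ : ℕ) : ℝ≥0) : ℝ) - t| ≤ S.lam * 1 :=
      mul_le_mul_of_nonneg_left h5 (zero_le_one.trans S.one_le_lam)
    have h9 := dist_triangle (γ ((⌊t⌋₊ : ℕ) : ℝ≥0)) (g n ((⌊t⌋₊ : ℕ) : ℝ≥0)) (g n t)
    rw [dist_comm] at h3
    rw [hfl t]
    unfold k₁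
    linarith

theorem Good.dist_le (hγ : γ ∈ S.Good) {s t : ℝ≥0} (hs : s ∈ γ.Dom) (ht : t ∈ γ.Dom) :
    dist (γ s) (γ t) ≤ S.lam * |(s : ℝ) - t| + (S.k + 2 * (S.k₁ + 1)) := by
  have hm : max s t ∈ γ.Dom := by
    rcases max_choice s t with h | h <;> rw [h] <;> assumption
  obtain ⟨g, hg, -, hD, hd⟩ := exists_approx hγ hm
  have h1 := (S.quasiGeodesic g hg s (Curve.mem_Dom_of_le (le_max_left _ _) hD) t
    (Curve.mem_Dom_of_le (le_max_right _ _) hD)).2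
  have h2 := hd s (le_max_left _ _)
  have h3 := hd t (le_max_right _ _)
  have h4 := dist_triangle4 (γ s) (g s) (g t) (γ t)
  rw [dist_comm (g t)] at h4
  linarith

/-- Replacing each curve by an approximating segment costs `k₁ + 1` per endpoint, in total `2(1 +
E)(k₁ + 1) + C`, which is at most `2D` because `k₁ ≥ 1`. -/
theorem Good.convex (hγ : γ ∈ S.Good) (hη : η ∈ S.Good) {t s : ℝ≥0} (ht : t ∈ γ.Dom)
    (hs : s ∈ η.Dom) {c : ℝ≥0} (hc : c ≤ 1) :
    dist (γ (c * t)) (η (c * s)) ≤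
      c * S.E * dist (γ t) (η s) + (1 - (c : ℝ)) * S.E * dist (γ 0) (η 0) + 2 * S.D := by
  obtain ⟨g, hg, hg0, hgD, hgd⟩ := exists_approx hγ ht
  obtain ⟨h, hh, hh0, hhD, hhd⟩ := exists_approx hη hs
  have h1 := S.convex g hg h hh t hgD s hhD c hc
  rw [hg0, hh0] at h1
  have h2 := hgd _ (mul_le_of_le_one_left zero_le hc)
  have h3 := hhd _ (mul_le_of_le_one_left zero_le hc)
  have h4 := dist_triangle4 (γ (c * t)) (g (c * t)) (h (c * s)) (η (c * s))
  have h5 := dist_triangle4 (g t) (γ t) (η s) (h s)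
  have h6 := hgd t le_rfl
  have h7 := hhd s le_rfl
  rw [dist_comm (h _)] at h4
  rw [dist_comm (g t) (γ t)] at h5
  have hE := S.one_le_E
  have hk := S.one_le_k₁
  have hC := S.C_nonneg
  have hc' : (c : ℝ) ≤ 1 := by exact_mod_cast hc
  have hcE : (c : ℝ) * S.E ≤ S.E := mul_le_of_le_one_left (by linarith) hc'
  have hcE0 : 0 ≤ (c : ℝ) * S.E := by positivity
  have h8 : (c : ℝ) * S.E * dist (g t) (h s) ≤
      c * S.E * (dist (γ t) (η s) + 2 * (S.k₁ + 1)) :=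
    mul_le_mul_of_nonneg_left (by linarith) hcE0
  have h9 : (c : ℝ) * S.E * (2 * (S.k₁ + 1)) ≤ S.E * (2 * (S.k₁ + 1)) :=
    mul_le_mul_of_nonneg_right hcE (by linarith)
  have h10 : 0 ≤ (1 + S.E) * (S.k₁ - 1) := mul_nonneg (by linarith) (by linarith)
  unfold D
  nlinarith

theorem Good.param (hγ : γ ∈ S.Good) (hη : η ∈ S.Good) {t s : ℝ≥0} (ht : t ∈ γ.Dom)
    (hs : s ∈ η.Dom) {r : ℝ} (hr : dist (γ 0) (η 0) + dist (γ t) (η s) ≤ r) :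
    |(t : ℝ) - s| ≤ S.θ (r + 2 * (S.k₁ + 1)).toNNReal := by
  obtain ⟨g, hg, hg0, hgD, hgd⟩ := exists_approx hγ ht
  obtain ⟨h, hh, hh0, hhD, hhd⟩ := exists_approx hη hs
  refine (S.param g hg h hh t hgD s hhD).trans (NNReal.coe_le_coe.2 (S.θ_mono ?_))
  rw [hg0, hh0]
  refine NNReal.le_toNNReal_of_coe_le ?_
  push_cast
  have h5 := dist_triangle4 (g t) (γ t) (η s) (h s)
  have h6 := hgd t le_rfl
  have h7 := hhd s le_rfl
  rw [dist_comm (g t) (γ t)] at h5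
  linarith

/-- Two good curves whose initial points and whose points at almost equal times `t`, `s` are close
fellow-travel up to the time `min t s`. -/
theorem Good.dist_le_of_close (hγ : γ ∈ S.Good) (hη : η ∈ S.Good) {t s : ℝ≥0} (ht : t ∈ γ.Dom)
    (hs : s ∈ η.Dom) {M R : ℝ} (h0 : dist (γ 0) (η 0) ≤ M) (h1 : dist (γ t) (η s) ≤ M)
    (hR : |(t : ℝ) - s| ≤ R) {u : ℝ≥0} (hut : u ≤ t) (hus : u ≤ s) :
    dist (γ u) (η u) ≤ S.E * M + 2 * S.D + (S.lam * R + (S.k + 2 * (S.k₁ + 1))) := by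
  -- Convexity compares `γ u` with `η (c * s)`, whose time differs from `u` by only `c |s - t| ≤ R`.
  obtain ⟨c, hc, hcu⟩ : ∃ c : ℝ≥0, c ≤ 1 ∧ c * t = u := by
    rcases eq_or_ne t 0 with rfl | h
    · exact ⟨0, zero_le_one, by simpa using (le_zero_iff.1 hut).symm⟩
    · exact ⟨u / t, div_le_one_of_le₀ hut zero_le, div_mul_cancel₀ u h⟩
  have h2 := Good.convex hγ hη ht hs hc
  have hcs : c * s ∈ η.Dom := Curve.mem_Dom_of_le (mul_le_of_le_one_left zero_le hc) hs
  have h3 := Good.dist_le hη hcs (Curve.mem_Dom_of_le hus hs)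
  have hc' : (c : ℝ) ≤ 1 := by exact_mod_cast hc
  have hE := S.one_le_E
  have hl := S.one_le_lam
  rw [hcu] at h2
  have h4 : |((c * s : ℝ≥0) : ℝ) - u| ≤ R := by
    rw [← hcu]
    push_cast
    rw [← mul_sub, abs_mul, abs_of_nonneg (NNReal.coe_nonneg c), abs_sub_comm (s : ℝ)]
    exact (mul_le_of_le_one_left (abs_nonneg _) hc').trans hR
  have h5 := dist_triangle (γ u) (η (c * s)) (η u)
  have h6 : S.lam * |((c * s : ℝ≥0) : ℝ) - u| ≤ S.lam * R :=
    mul_le_mul_of_nonneg_left h4 (by linarith)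
  have h7 : (c : ℝ) * S.E * dist (γ t) (η s) ≤ c * S.E * M :=
    mul_le_mul_of_nonneg_left h1 (by positivity)
  have h8 : (1 - (c : ℝ)) * S.E * dist (γ 0) (η 0) ≤ (1 - (c : ℝ)) * S.E * M :=
    mul_le_mul_of_nonneg_left h0 (mul_nonneg (by linarith) (by linarith))
  linarith

theorem le_curveProd {t : ℝ≥0} (h1 : t ∈ γ.Dom) (h2 : t ∈ η.Dom)
    (h : dist (γ t) (η t) ≤ 2 * S.D + 2) : (t : ℝ≥0∞) ≤ S.curveProd γ η :=
  le_sSup ⟨t, ⟨⟨h1, h2⟩, h⟩, rfl⟩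

theorem curveProd_comm (γ η : Curve X) : S.curveProd γ η = S.curveProd η γ := by
  unfold curveProd
  simp only [Set.inter_comm γ.Dom, dist_comm (γ _)]

theorem Good.dist_le_of_lt_curveProd (hγ : γ ∈ S.Good) (hη : η ∈ S.Good) (h0 : γ 0 = η 0)
    {t : ℝ≥0} (h : (t : ℝ≥0∞) < S.curveProd γ η) :
    t ∈ γ.Dom ∧ t ∈ η.Dom ∧ dist (γ t) (η t) ≤
      S.E * (2 * S.D + 2) + 2 * S.D + (S.lam * 0 + (S.k + 2 * (S.k₁ + 1))) := by
  obtain ⟨_, ⟨s, ⟨⟨hs1, hs2⟩, hs⟩, rfl⟩, hts⟩ := lt_sSup_iff.1 h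
  have hts' : t ≤ s := (ENNReal.coe_lt_coe.1 hts).le
  have := S.D_nonneg
  exact ⟨Curve.mem_Dom_of_le hts' hs1, Curve.mem_Dom_of_le hts' hs2,
    Good.dist_le_of_close hγ hη hs1 hs2 (by rw [h0, dist_self]; linarith) hs (by simp) hts' hts'⟩

/-- The contraction property: if `γ` and `η` start at the same point and are `M`-close at time `t`,
then `(γ ∣ η)` is at least a definite proportion of `t`. -/
theorem Good.mul_le_curveProd (hγ : γ ∈ S.Good) (hη : η ∈ S.Good) (h0 : γ 0 = η 0)
    {t : ℝ≥0} (h1 : t ∈ γ.Dom) (h2 : t ∈ η.Dom) {M : ℝ} (h : dist (γ t) (η t) ≤ M)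
    {c : ℝ≥0} (hc : c ≤ 1) (hcM : c * S.E * M ≤ 1) : ((c * t : ℝ≥0) : ℝ≥0∞) ≤ S.curveProd γ η := by
  have hle : c * t ≤ t := mul_le_of_le_one_left zero_le hc
  refine le_curveProd (Curve.mem_Dom_of_le hle h1) (Curve.mem_Dom_of_le hle h2) ?_
  have h3 := Good.convex hγ hη h1 h2 hc
  have hE := S.one_le_E
  have h4 : (c : ℝ) * S.E * dist (γ t) (η t) ≤ c * S.E * M :=
    mul_le_mul_of_nonneg_left h (by positivity)
  rw [h0, dist_self] at h3
  linarith

/-- Equivalent rays with the same initial point are uniformly close. -/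
theorem dist_le_of_equivalent (hγ : γ ∈ S.Linf) (hη : η ∈ S.Linf) (h0 : γ 0 = η 0)
    (h : BddAbove (Set.range fun t : ℝ≥0 => dist (γ t) (η t))) (t : ℝ≥0) :
    dist (γ t) (η t) ≤ 2 * S.D + 1 := by
  obtain ⟨M, hM⟩ := h
  have hM0 : 0 ≤ M := dist_nonneg.trans (hM ⟨0, rfl⟩)
  have hE := S.one_le_E
  have hEM : 0 ≤ S.E * M := by positivity
  -- Contracting from the later time `r * t` by the factor `1/r` reduces the unknown bound `M` to at
  -- most `1`.
  obtain ⟨r, hr⟩ : ∃ r : ℝ≥0, (r : ℝ) = S.E * M + 1 := ⟨⟨S.E * M + 1, by positivity⟩, rfl⟩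
  have hr0 : r ≠ 0 := by
    rw [← NNReal.coe_ne_zero, hr]
    positivity
  have hr1 : r⁻¹ ≤ 1 := by
    refine inv_le_one_of_one_le₀ ?_
    rw [← NNReal.coe_le_coe, hr, NNReal.coe_one]
    linarith
  have h1 := Good.convex (Or.inr hγ) (Or.inr hη) (mem_Dom_of_mem_Linf hγ (r * t))
    (mem_Dom_of_mem_Linf hη (r * t)) hr1
  rw [inv_mul_cancel_left₀ hr0, h0, dist_self] at h1
  have h2 : ((r⁻¹ : ℝ≥0) : ℝ) * S.E * dist (γ (r * t)) (η (r * t)) ≤ 1 := by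
    have h3 : S.E * dist (γ (r * t)) (η (r * t)) ≤ (r : ℝ) :=
      calc S.E * dist (γ (r * t)) (η (r * t)) ≤ S.E * M :=
            mul_le_mul_of_nonneg_left (hM ⟨_, rfl⟩) (by linarith)
        _ ≤ (r : ℝ) := by rw [hr]; linarith
    rw [mul_assoc, NNReal.coe_inv]
    exact inv_mul_le_one_of_le₀ h3 r.2
  linarith

/-- Good segments from `O` whose lengths tend to infinity subconverge to a ray. -/
theorem exists_ray_of_segments [ProperSpace X] {O : X} (h : ℕ → Curve X) (hL : ∀ n, h n ∈ S.L)
    (h0 : ∀ n, h n 0 = O) (hlen : Tendsto (fun n => (h n).len) atTop (𝓝 ∞)) :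
    ∃ g ∈ S.Linf, g 0 = O ∧ ∃ φ : ℕ → ℕ, StrictMono φ ∧
      ∀ m : ℕ, Tendsto (fun n => h (φ n) (m : ℝ≥0)) atTop (𝓝 (g (m : ℝ≥0))) := by
  classical
  -- Values outside the domain are arbitrary; the default `O` puts every `v n` in a compact product
  -- of balls. For fixed `m` the default eventually disappears.
  let v : ℕ → ℕ → X := fun n m => if (m : ℝ≥0) ∈ (h n).Dom then h n (m : ℝ≥0) else O
  have hv : ∀ n, v n ∈ Set.pi Set.univ fun m : ℕ => Metric.closedBall O (S.lam * m + S.k) := by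
    intro n m _
    have hl := S.one_le_lam
    have hk := S.k_nonneg
    rw [Metric.mem_closedBall]
    by_cases hm : (m : ℝ≥0) ∈ (h n).Dom
    · have := (S.quasiGeodesic _ (hL n) m hm 0 (Curve.mem_Dom_of_le zero_le hm)).2
      simpa [v, hm, h0] using this
    · simp only [v, hm, if_false, dist_self]
      positivity
  obtain ⟨u, -, φ, hφ, hu⟩ :=
    (isCompact_univ_pi fun m : ℕ => isCompact_closedBall O (S.lam * m + S.k)).tendsto_subseq hv
  have hlim : ∀ m : ℕ, Tendsto (fun n => h (φ n) (m : ℝ≥0)) atTop (𝓝 (u m)) := by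
    intro m
    refine ((tendsto_pi_nhds.1 hu) m).congr' ?_
    filter_upwards [(hlen.comp hφ.tendsto_atTop).eventually
      (lt_mem_nhds (ENNReal.coe_lt_top (r := (m : ℝ≥0))))] with n hn
    have : (m : ℝ≥0) ∈ (h (φ n)).Dom := hn.le
    simp [v, this]
  have hu0 : u 0 = O := by
    refine tendsto_nhds_unique (hlim 0) ?_
    simp [h0]
  refine ⟨⟨∞, fun t => u ⌊t⌋₊⟩, ⟨rfl, ⟨fun n => h (φ n), fun n => ⟨hL _, ?_⟩,
    hlen.comp hφ.tendsto_atTop, fun m => ?_⟩, fun t => ?_⟩, ?_, φ, hφ, fun m => ?_⟩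
  · simpa [h0] using hu0.symm
  · simpa using hlim m
  · simp
  · simpa using hu0
  · simpa using hlim m

end Good

end CoarseConvexity

/-! ### The product as fellow-travelling time -/

namespace CoarseConvexity

namespace Bar

section Fellow

variable {X : Type*} [MetricSpace X] {S : CoarseConvexity X} {O : X}

theorem good_of_mem_curvesTo {x : S.Bar O} {γ : Curve X} (h : γ ∈ x.curvesTo) :
    γ ∈ S.Good ∧ γ 0 = O := by
  cases x with
  | point x => exact ⟨Or.inl h.1, h.2.2.1⟩
  | ideal ξ => exact ⟨Or.inr h.2.1, h.1⟩

/-- Away from `O`, every good segment from `O` to a point `x` belongs to `curvesTo x`. -/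
theorem mem_curvesTo_of_not_isNear {x : X} (h : ¬ (point x : S.Bar O).IsNear) {γ : Curve X}
    (hγ : γ ∈ S.L) (h0 : γ 0 = O) (h1 : γ.terminal = x) : γ ∈ (point x : S.Bar O).curvesTo := by
  refine ⟨hγ, ?_, h0, h1⟩
  by_contra hlt
  rw [not_le] at hlt
  apply h
  have hq := (S.quasiGeodesic γ hγ _ (len_toNNReal_mem_Dom hγ) 0
    (Curve.mem_Dom_of_le zero_le (len_toNNReal_mem_Dom hγ))).2
  have hl : (γ.len.toNNReal : ℝ) ≤ 2 * S.θ 0 := by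
    rw [← ENNReal.coe_toNNReal (S.len_ne_top γ hγ)] at hlt
    exact_mod_cast (ENNReal.coe_lt_coe.1 hlt).le
  have h2 : S.lam * (γ.len.toNNReal : ℝ) ≤ S.lam * (2 * S.θ 0) :=
    mul_le_mul_of_nonneg_left hl (zero_le_one.trans S.one_le_lam)
  rw [h0, NNReal.coe_zero, sub_zero, abs_of_nonneg (NNReal.coe_nonneg _)] at hq
  change dist x O ≤ _
  rw [← h1]
  unfold Curve.terminal
  linarith

/-- There are good curves from `O` to `x` and to `y` that are `M`-close at time `t`. -/
def Fellow (x y : S.Bar O) (t : ℝ≥0) (M : ℝ) : Prop :=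
  ¬ x.IsNear ∧ ¬ y.IsNear ∧ ∃ γ ∈ x.curvesTo, ∃ η ∈ y.curvesTo,
    t ∈ γ.Dom ∧ t ∈ η.Dom ∧ dist (γ t) (η t) ≤ M

theorem gprod_comm (x y : S.Bar O) : gprod x y = gprod y x := by
  unfold gprod
  by_cases h : x.IsNear ∨ y.IsNear
  · rw [if_pos h, if_pos h.symm]
  · rw [if_neg h, if_neg fun h' => h h'.symm, iSup₂_comm]
    exact iSup_congr fun γ => iSup_congr fun _ => iSup_congr fun η => iSup_congr fun _ =>
      curveProd_comm η γ

theorem exists_fellow_of_lt_gprod (S : CoarseConvexity X) (O : X) :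
    ∃ M : ℝ, ∀ (x y : S.Bar O) (t : ℝ≥0), (t : ℝ≥0∞) < gprod x y → Fellow x y t M := by
  refine ⟨S.E * (2 * S.D + 2) + 2 * S.D + (S.lam * 0 + (S.k + 2 * (S.k₁ + 1))),
    fun x y t h => ?_⟩
  unfold gprod at h
  split_ifs at h with hn
  · exact absurd h (by simp)
  · rw [not_or] at hn
    simp only [lt_iSup_iff] at h
    obtain ⟨γ, hγ, η, hη, h⟩ := h
    have h1 := good_of_mem_curvesTo hγ
    have h2 := good_of_mem_curvesTo hη
    exact ⟨hn.1, hn.2, γ, hγ, η, hη,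
      Good.dist_le_of_lt_curveProd h1.1 h2.1 (h1.2.trans h2.2.symm) h⟩

/-- Converse to `exists_fellow_of_lt_gprod`, by contraction. The factor depends on `M` only, not on
the points or the time. -/
theorem exists_mul_le_gprod (S : CoarseConvexity X) (O : X) (M : ℝ) :
    ∃ c : ℝ≥0, 0 < c ∧ ∀ (x y : S.Bar O) (t : ℝ≥0), Fellow x y t M →
      ((c * t : ℝ≥0) : ℝ≥0∞) ≤ gprod x y := by
  have hE := S.one_le_E
  obtain ⟨r, hr⟩ : ∃ r : ℝ≥0, (r : ℝ) = S.E * |M| + 1 := ⟨⟨S.E * |M| + 1, by positivity⟩, rfl⟩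
  have hr1 : 1 ≤ r := by
    rw [← NNReal.coe_le_coe, hr, NNReal.coe_one]
    have : 0 ≤ S.E * |M| := by positivity
    linarith
  refine ⟨r⁻¹, inv_pos.2 (zero_lt_one.trans_le hr1), fun x y t h => ?_⟩
  obtain ⟨hx, hy, γ, hγ, η, hη, h1, h2, h3⟩ := h
  have h4 := good_of_mem_curvesTo hγ
  have h5 := good_of_mem_curvesTo hη
  unfold gprod
  rw [if_neg (not_or.2 ⟨hx, hy⟩)]
  refine le_iSup₂_of_le γ hγ (le_iSup₂_of_le η hη ?_)
  refine Good.mul_le_curveProd h4.1 h5.1 (h4.2.trans h5.2.symm) h1 h2 h3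
    (inv_le_one_of_one_le₀ hr1) ?_
  rw [NNReal.coe_inv, mul_assoc]
  refine inv_mul_le_one_of_le₀ ?_ (NNReal.coe_nonneg r)
  rw [hr]
  have : S.E * M ≤ S.E * |M| := mul_le_mul_of_nonneg_left (le_abs_self M) (by linarith)
  linarith

/-- Good curves from `O` to the same point are uniformly close. -/
theorem exists_dist_le_of_mem_curvesTo (S : CoarseConvexity X) (O : X) :
    ∃ M : ℝ, ∀ (x : S.Bar O), ∀ γ ∈ x.curvesTo, ∀ η ∈ x.curvesTo, ∀ t : ℝ≥0, t ∈ γ.Dom →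
      t ∈ η.Dom → dist (γ t) (η t) ≤ M := by
  refine ⟨max (2 * S.D + 1) (S.E * 0 + 2 * S.D + (S.lam * S.θ 0 + (S.k + 2 * (S.k₁ + 1)))),
    fun x γ hγ η hη t h1 h2 => ?_⟩
  cases x with
  | point x =>
    refine le_trans ?_ (le_max_right _ _)
    have h0 : γ 0 = η 0 := hγ.2.2.1.trans hη.2.2.1.symm
    have he : γ γ.len.toNNReal = η η.len.toNNReal := hγ.2.2.2.trans hη.2.2.2.symm
    -- Two segments with the same endpoints have lengths differing by at most `θ 0`.
    have hp := S.param γ hγ.1 η hη.1 _ (len_toNNReal_mem_Dom hγ.1) _ (len_toNNReal_mem_Dom hη.1)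
    rw [h0, he, nndist_self, nndist_self, add_zero] at hp
    exact Good.dist_le_of_close (M := 0) (Or.inl hγ.1) (Or.inl hη.1) (len_toNNReal_mem_Dom hγ.1)
      (len_toNNReal_mem_Dom hη.1) (by rw [h0, dist_self]) (by rw [he, dist_self]) hp
      (le_len_toNNReal hγ.1 h1) (le_len_toNNReal hη.1 h2)
  | ideal ξ =>
    refine le_trans ?_ (le_max_left _ _)
    obtain ⟨hγ0, hγL, hγc⟩ := hγ
    obtain ⟨hη0, hηL, hηc⟩ := hη
    exact dist_le_of_equivalent hγL hηL (hγ0.trans hη0.symm)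
      (Quotient.exact (s := S.raySetoid) (hγc.trans hηc.symm)) t

/-- The two hypotheses may use different good curves to `y`; the constant `M` pays for passing
between them. -/
theorem exists_fellow_trans (S : CoarseConvexity X) (O : X) :
    ∃ M : ℝ, ∀ (x y z : S.Bar O) (t : ℝ≥0) (M₁ M₂ : ℝ), Fellow x y t M₁ → Fellow y z t M₂ →
      Fellow x z t (M₁ + M + M₂) := by
  obtain ⟨M, hM⟩ := exists_dist_le_of_mem_curvesTo S O
  refine ⟨M, fun x y z t M₁ M₂ h h' => ?_⟩
  obtain ⟨hx, hy, γ, hγ, η, hη, h1, h2, h3⟩ := h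
  obtain ⟨-, hz, η', hη', ζ, hζ, h4, h5, h6⟩ := h'
  refine ⟨hx, hz, γ, hγ, ζ, hζ, h1, h5, (dist_triangle4 _ (η t) (η' t) _).trans ?_⟩
  have := hM y η hη η' hη' t h2 h4
  linarith

/-- The product `(· ∣ ·)` is a quasi-ultrametric at infinity. -/
theorem exists_lt_gprod_trans (S : CoarseConvexity X) (O : X) (n : ℕ) :
    ∃ m : ℕ, ∀ x y z : S.Bar O, (m : ℝ≥0∞) < gprod x y → (m : ℝ≥0∞) < gprod y z →
      (n : ℝ≥0∞) < gprod x z := by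
  obtain ⟨M₀, h₀⟩ := exists_fellow_of_lt_gprod S O
  obtain ⟨M₁, h₁⟩ := exists_fellow_trans S O
  obtain ⟨c, hc, h₂⟩ := exists_mul_le_gprod S O (M₀ + M₁ + M₀)
  obtain ⟨m, hm⟩ := exists_nat_gt ((n : ℝ≥0) / c)
  refine ⟨m, fun x y z hxy hyz => ?_⟩
  have h := h₂ x z m (h₁ x y z m _ _ (h₀ x y m (by simpa using hxy)) (h₀ y z m (by simpa using hyz)))
  refine lt_of_lt_of_le ?_ h
  rw [div_lt_iff₀' hc] at hm
  exact_mod_cast hm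

/-- If `y` is far from `O`, then the good segments to points near `y` fellow-travel those to `y`. -/
theorem exists_lt_gprod_of_dist_lt (S : CoarseConvexity X) (O : X) (n : ℕ) :
    ∃ m : ℕ, ∀ (x : S.Bar O) (y z : X), (m : ℝ≥0∞) < gprod x (point y) → dist y z ≤ 1 →
      (n : ℝ≥0∞) < gprod x (point z) := by
  obtain ⟨M₀, h₀⟩ := exists_fellow_of_lt_gprod S O
  obtain ⟨M₁, h₁⟩ := exists_fellow_trans S O
  set M₂ : ℝ := S.E * 1 + 2 * S.D + (S.lam * S.θ 1 + (S.k + 2 * (S.k₁ + 1))) with hM₂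
  obtain ⟨c, hc, h₂⟩ := exists_mul_le_gprod S O (M₀ + M₁ + M₂)
  -- `i` is the fellow-travelling time needed, `j` absorbs the difference in length of segments to
  -- `y` and `z`, and `l` keeps `z` out of the ball about `O`.
  obtain ⟨i, hi⟩ := exists_nat_gt ((n : ℝ≥0) / c)
  obtain ⟨j, hj⟩ := exists_nat_ge (S.θ 1)
  obtain ⟨l, hl⟩ := exists_nat_gt (S.lam * (2 * S.lam * S.θ 0 + S.k + 1 + S.k))
  refine ⟨i + j + l, fun x y z hxy hyz => ?_⟩
  have hlam := S.one_le_lam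
  obtain ⟨hx, hy, γ, hγ, η, hη, h3, h4, -⟩ := h₀ x (point y) (i + j + l : ℕ) (by simpa using hxy)
  obtain ⟨hηL, -, hη0, hηy⟩ := hη
  have hlen := le_len_toNNReal hηL h4
  have hlenR : (i : ℝ) + j + l ≤ η.len.toNNReal := by exact_mod_cast hlen
  have hz : ¬ (point z : S.Bar O).IsNear := by
    intro hz
    change dist z O ≤ _ at hz
    have h5 := (S.quasiGeodesic η hηL _ (len_toNNReal_mem_Dom hηL) 0
      (Curve.mem_Dom_of_le zero_le (len_toNNReal_mem_Dom hηL))).1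
    rw [hη0, NNReal.coe_zero, sub_zero, abs_of_nonneg (NNReal.coe_nonneg _)] at h5
    change _ ≤ dist η.terminal O at h5
    rw [hηy] at h5
    have h6 := dist_triangle y z O
    have h7 : S.lam⁻¹ * (η.len.toNNReal : ℝ) ≤ 2 * S.lam * S.θ 0 + S.k + 1 + S.k := by linarith
    rw [inv_mul_le_iff₀ (by linarith)] at h7
    have : (0 : ℝ) ≤ i := Nat.cast_nonneg i
    have : (0 : ℝ) ≤ j := Nat.cast_nonneg j
    linarith
  obtain ⟨ζ, hζL, hζ0, hζz⟩ := S.connected O z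
  have hζ := mem_curvesTo_of_not_isNear hz hζL hζ0 hζz
  have h0 : η 0 = ζ 0 := hη0.trans hζ0.symm
  have he : dist (η η.len.toNNReal) (ζ ζ.len.toNNReal) ≤ 1 := by
    change dist η.terminal ζ.terminal ≤ 1
    rwa [hηy, hζz]
  have hp : |(η.len.toNNReal : ℝ) - ζ.len.toNNReal| ≤ S.θ 1 := by
    refine (S.param η hηL ζ hζL _ (len_toNNReal_mem_Dom hηL) _ (len_toNNReal_mem_Dom hζL)).trans
      (NNReal.coe_le_coe.2 (S.θ_mono ?_))
    rw [h0, nndist_self, zero_add]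
    exact he
  have hit : (i : ℝ≥0) ≤ η.len.toNNReal := by
    refine le_trans ?_ hlen
    push_cast
    rw [add_assoc]
    exact le_self_add
  have his : (i : ℝ≥0) ≤ ζ.len.toNNReal := by
    have hj' : (S.θ 1 : ℝ) ≤ j := by exact_mod_cast hj
    have : (0 : ℝ) ≤ l := Nat.cast_nonneg l
    have h9 : (i : ℝ) ≤ ζ.len.toNNReal := by linarith [(abs_le.1 hp).2]
    exact_mod_cast h9
  have hyz' : Fellow (point y : S.Bar O) (point z) i M₂ :=
    ⟨hy, hz, η, mem_curvesTo_of_not_isNear hy hηL hη0 hηy, ζ, hζ,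
      Curve.mem_Dom_of_le hit (len_toNNReal_mem_Dom hηL),
      Curve.mem_Dom_of_le his (len_toNNReal_mem_Dom hζL),
      Good.dist_le_of_close (Or.inl hηL) (Or.inl hζL) (len_toNNReal_mem_Dom hηL)
        (len_toNNReal_mem_Dom hζL) (by rw [h0, dist_self]; exact zero_le_one) he hp hit his⟩
  have hxy' : Fellow x (point y : S.Bar O) i M₀ := by
    refine h₀ x (point y) i (lt_of_le_of_lt ?_ hxy)
    exact_mod_cast (by omega : i ≤ i + j + l)
  refine lt_of_lt_of_le ?_ (h₂ x (point z) i (h₁ _ _ _ _ _ _ hxy' hyz'))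
  rw [div_lt_iff₀' hc] at hi
  exact_mod_cast hi

end Fellow

/-! ### Convergence to ideal points -/

section Ideal

variable {X : Type*} [MetricSpace X] {S : CoarseConvexity X} {O : X}

theorem not_isNear_of_lt {x : X} {γ : Curve X} (hγ : γ ∈ S.L) (h0 : γ 0 = O)
    (h1 : γ.terminal = x)
    (h : S.lam * (2 * S.lam * S.θ 0 + S.k + S.k) < γ.len.toNNReal) :
    ¬ (point x : S.Bar O).IsNear := by
  intro hx
  change dist x O ≤ _ at hx
  have h5 := (S.quasiGeodesic γ hγ _ (len_toNNReal_mem_Dom hγ) 0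
    (Curve.mem_Dom_of_le zero_le (len_toNNReal_mem_Dom hγ))).1
  rw [h0, NNReal.coe_zero, sub_zero, abs_of_nonneg (NNReal.coe_nonneg _)] at h5
  change _ ≤ dist γ.terminal O at h5
  rw [h1] at h5
  have h7 : S.lam⁻¹ * (γ.len.toNNReal : ℝ) ≤ 2 * S.lam * S.θ 0 + S.k + S.k := by linarith
  rw [inv_mul_le_iff₀ (zero_lt_one.trans_le S.one_le_lam)] at h7
  linarith

/-- The points of a ray converge to its class. -/
theorem exists_lt_gprod_ray [ProperSpace X] (O : X) (γ : S.Linf) (N : ℕ) :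
    ∃ m : ℕ, ∀ n ≥ m,
      (N : ℝ≥0∞) < gprod (point (γ.1 (n : ℝ≥0)) : S.Bar O) (ideal (S.cls γ)) := by
  have hγ : (γ : Curve X) ∈ S.Good := Or.inr γ.2
  -- `γ` need not start at `O`. The segments from `O` to its points follow it at bounded distance
  -- and subconverge to a ray from `O` in the same class.
  choose h hL h0 h1 using fun n : ℕ => S.connected O (γ.1 (n : ℝ≥0))
  set M : ℝ := dist O (γ.1 0) with hM
  obtain ⟨R, hR⟩ : ∃ R : ℝ≥0, ∀ n : ℕ, |((h n).len.toNNReal : ℝ) - (n : ℝ≥0)| ≤ R := by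
    refine ⟨_, fun n => Good.param (r := M) (Or.inl (hL n)) hγ (len_toNNReal_mem_Dom (hL n))
      (mem_Dom_of_mem_Linf γ.2 _) ?_⟩
    have : h n (h n).len.toNNReal = γ.1 (n : ℝ≥0) := h1 n
    rw [this, dist_self, h0]
    simp [hM]
  obtain ⟨r, hr⟩ := exists_nat_ge R
  have hlen : ∀ n u : ℕ, u + r ≤ n → (u : ℝ≥0) ≤ (h n).len.toNNReal := by
    intro n u hu
    have h2 := (abs_le.1 (hR n)).1
    have h3 : (u : ℝ) + r ≤ n := by exact_mod_cast hu
    have h4 : (R : ℝ) ≤ r := by exact_mod_cast hr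
    have h5 : (u : ℝ) ≤ (h n).len.toNNReal := by
      rw [NNReal.coe_natCast] at h2
      linarith
    exact_mod_cast h5
  obtain ⟨M', hclose⟩ : ∃ M' : ℝ, ∀ n u : ℕ, u + r ≤ n →
      dist (h n (u : ℝ≥0)) (γ.1 (u : ℝ≥0)) ≤ M' := by
    refine ⟨_, fun n u hu => Good.dist_le_of_close (M := M) (Or.inl (hL n)) hγ
      (len_toNNReal_mem_Dom (hL n)) (mem_Dom_of_mem_Linf γ.2 (n : ℝ≥0)) ?_ ?_ (hR n)
      (hlen n u hu) (Nat.cast_le.2 (by omega))⟩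
    · rw [h0]
    · have : h n (h n).len.toNNReal = γ.1 (n : ℝ≥0) := h1 n
      rw [this, dist_self]
      exact dist_nonneg
  have htop : Tendsto (fun n => (h n).len) atTop (𝓝 ∞) := by
    refine ENNReal.tendsto_nhds_top fun u => ?_
    filter_upwards [eventually_ge_atTop (u + 1 + r)] with n hn
    have h2 := hlen n (u + 1) hn
    rw [← ENNReal.coe_le_coe, ENNReal.coe_toNNReal (S.len_ne_top _ (hL n))] at h2
    refine lt_of_lt_of_le ?_ h2
    exact_mod_cast Nat.lt_succ_self u
  obtain ⟨g, hg, hg0, φ, hφ, hlim⟩ := exists_ray_of_segments h hL h0 htop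
  have hgγ : ∀ u : ℕ, dist (g (u : ℝ≥0)) (γ.1 (u : ℝ≥0)) ≤ M' := by
    intro u
    refine le_of_tendsto ((hlim u).dist tendsto_const_nhds) ?_
    filter_upwards [hφ.tendsto_atTop.eventually (eventually_ge_atTop (u + r))] with n hn
    exact hclose _ _ hn
  have hcls : S.cls ⟨g, hg⟩ = S.cls γ := by
    refine Quotient.sound (s := S.raySetoid) ⟨M', ?_⟩
    rintro _ ⟨t, rfl⟩
    change dist (g t) (γ.1 t) ≤ M'
    rw [hg.2.2 t, γ.2.2.2 t]
    exact hgγ _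
  obtain ⟨c, hc, h₂⟩ := exists_mul_le_gprod S O (M' + M')
  obtain ⟨i, hi⟩ := exists_nat_gt ((N : ℝ≥0) / c)
  obtain ⟨l, hl⟩ := exists_nat_gt (S.lam * (2 * S.lam * S.θ 0 + S.k + S.k))
  refine ⟨i + l + r, fun n hn => ?_⟩
  have hnear : ¬ (point (γ.1 (n : ℝ≥0)) : S.Bar O).IsNear := by
    refine not_isNear_of_lt (hL n) (h0 n) (h1 n) (hl.trans_le ?_)
    exact_mod_cast hlen n l (by omega)
  have hi' : i + r ≤ n := by omega
  refine lt_of_lt_of_le ?_ (h₂ _ _ i ⟨hnear, id, h n, mem_curvesTo_of_not_isNear hnear (hL n) (h0 n)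
    (h1 n), g, ⟨hg0, hg, hcls⟩, Curve.mem_Dom_of_le (hlen n i hi') (len_toNNReal_mem_Dom (hL n)),
    mem_Dom_of_mem_Linf hg _, ?_⟩)
  · rw [div_lt_iff₀' hc] at hi
    exact_mod_cast hi
  · refine (dist_triangle_right _ _ (γ.1 (i : ℝ≥0))).trans (add_le_add (hclose n i hi') (hgγ i))

/-- Pass from `ξ` to itself through a far point of a representing ray. -/
theorem gprod_ideal_self [ProperSpace X] (ξ : S.Boundary) : gprod (ideal ξ : S.Bar O) (ideal ξ) = ∞ := by
  refine ENNReal.eq_top_of_forall_nnreal_le fun r => ?_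
  obtain ⟨N, hN⟩ := exists_nat_ge r
  obtain ⟨m, hm⟩ := exists_lt_gprod_trans S O N
  obtain ⟨γ, rfl⟩ : ∃ γ, S.cls γ = ξ := Quotient.exists_rep ξ
  obtain ⟨n, hn⟩ := exists_lt_gprod_ray O γ m
  have h := hn n le_rfl
  refine le_trans ?_ (hm _ _ _ (by rwa [gprod_comm]) h).le
  exact_mod_cast hN

/-- A sequence with `(yₙ ∣ yₘ) → ∞` converges to an ideal point. -/
theorem exists_ideal_of_cauchy [ProperSpace X] (y : ℕ → X)
    (hy : ∀ N : ℕ, ∃ M : ℕ, ∀ n ≥ M, ∀ m ≥ M,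
      (N : ℝ≥0∞) < gprod (point (y n) : S.Bar O) (point (y m))) :
    ∃ η : S.Boundary, ∀ N : ℕ, ∃ M : ℕ, ∀ n ≥ M,
      (N : ℝ≥0∞) < gprod (point (y n) : S.Bar O) (ideal η) := by
  obtain ⟨M₀, h₀⟩ := exists_fellow_of_lt_gprod S O
  choose M hM using hy
  have hex : ∀ j : ℕ, ∃ n ≥ j, ¬ (point (y n) : S.Bar O).IsNear ∧
      ∃ γ ∈ (point (y n) : S.Bar O).curvesTo, (j : ℝ≥0) ∈ γ.Dom := by
    intro j
    -- With equal indices, a large product of a point with itself yields a long good segment ending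
    -- there.
    have h := hM j (max j (M j)) (le_max_right _ _) (max j (M j)) (le_max_right _ _)
    obtain ⟨h1, -, γ, hγ, -, -, h2, -⟩ := h₀ _ _ (j : ℝ≥0) (by simpa using h)
    exact ⟨_, le_max_left _ _, h1, γ, hγ, h2⟩
  choose ν hν hfar h hh hD using hex
  have htop : Tendsto (fun n => (h n).len) atTop (𝓝 ∞) := by
    refine ENNReal.tendsto_nhds_top fun u => ?_
    filter_upwards [eventually_ge_atTop (u + 1)] with n hn
    have h2 : ((n : ℝ≥0) : ℝ≥0∞) ≤ (h n).len := hD n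
    refine lt_of_lt_of_le ?_ h2
    exact_mod_cast hn
  obtain ⟨g, hg, hg0, φ, hφ, hlim⟩ := exists_ray_of_segments h (fun n => (hh n).1)
    (fun n => (hh n).2.2.1) htop
  refine ⟨S.cls ⟨g, hg⟩, fun N => ?_⟩
  obtain ⟨m, hm⟩ := exists_lt_gprod_trans S O N
  obtain ⟨c, hc, h₂⟩ := exists_mul_le_gprod S O 1
  obtain ⟨i, hi⟩ := exists_nat_gt ((m : ℝ≥0) / c)
  refine ⟨M m, fun n hn => ?_⟩
  obtain ⟨j, hj1, hj2⟩ := (((hlim i).eventually (Metric.closedBall_mem_nhds _ one_pos)).and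
    (hφ.tendsto_atTop.eventually (eventually_ge_atTop (max i (M m))))).exists
  refine hm _ (point (y (ν (φ j)))) _ (hM m n hn _ ?_) (lt_of_lt_of_le ?_ (h₂ _ _ i
    ⟨hfar _, id, h (φ j), hh _, g, ⟨hg0, hg, rfl⟩, Curve.mem_Dom_of_le ?_ (hD (φ j)),
      mem_Dom_of_mem_Linf hg _, hj1⟩))
  · exact (le_max_right _ _).trans (hj2.trans (hν _))
  · rw [div_lt_iff₀' hc] at hi
    exact_mod_cast hi
  · exact_mod_cast (le_max_left _ _).trans hj2

/-- Points at infinite product from an ideal point agree with it. -/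
theorem eq_of_forall_lt_gprod {z : S.Bar O} {ξ : S.Boundary}
    (h : ∀ N : ℕ, (N : ℝ≥0∞) < gprod z (ideal ξ)) : z = ideal ξ := by
  obtain ⟨M₀, h₀⟩ := exists_fellow_of_lt_gprod S O
  obtain ⟨M₁, h₁⟩ := exists_dist_le_of_mem_curvesTo S O
  have hF : ∀ n : ℕ, Fellow z (ideal ξ) n M₀ := fun n => h₀ _ _ n (by simpa using h n)
  cases z with
  | point x =>
    exfalso
    obtain ⟨n, hn⟩ := exists_nat_gt (S.lam * (dist x O + S.k))
    obtain ⟨-, -, γ, ⟨hγ, -, h0, h1⟩, -, -, h2, -⟩ := hF n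
    have h5 := (S.quasiGeodesic γ hγ _ (len_toNNReal_mem_Dom hγ) 0
      (Curve.mem_Dom_of_le zero_le (len_toNNReal_mem_Dom hγ))).1
    rw [h0, NNReal.coe_zero, sub_zero, abs_of_nonneg (NNReal.coe_nonneg _)] at h5
    change _ ≤ dist γ.terminal O at h5
    rw [h1, sub_le_iff_le_add, inv_mul_le_iff₀ (zero_lt_one.trans_le S.one_le_lam)] at h5
    have h6 : (n : ℝ) ≤ γ.len.toNNReal := by exact_mod_cast le_len_toNNReal hγ h2
    linarith
  | ideal ζ =>
    obtain ⟨-, -, γ, hγ, η, hη, -⟩ := hF 0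
    have hγ' := hγ
    have hη' := hη
    obtain ⟨-, hγL, rfl⟩ := hγ'
    obtain ⟨-, hηL, rfl⟩ := hη'
    congr 1
    refine Quotient.sound (s := S.raySetoid) ⟨M₁ + M₀ + M₁, ?_⟩
    rintro _ ⟨t, rfl⟩
    change dist (γ t) (η t) ≤ _
    rw [hγL.2.2 t, hηL.2.2 t]
    obtain ⟨-, -, γ', hγ', η', hη', h1, h2, h3⟩ := hF ⌊t⌋₊
    refine (dist_triangle4 _ _ _ _).trans (add_le_add_three (h₁ _ γ hγ γ' hγ' _
      (mem_Dom_of_mem_Linf hγL _) h1) h3 (h₁ _ η' hη' η hη _ h2 (mem_Dom_of_mem_Linf hηL _)))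

/-! ### Neighbourhoods and limits in the compactification -/

/-- The entourages `Vₙ` generate a uniform structure. -/
theorem exists_V_comp_subset (S : CoarseConvexity X) (O : X) (n : ℕ) (hn : 1 ≤ n) :
    ∃ m : ℕ, 1 ≤ m ∧ ∀ x y z : S.Bar O, (x, y) ∈ (V m : Set (S.Bar O × S.Bar O)) →
      (y, z) ∈ (V m : Set (S.Bar O × S.Bar O)) → (x, z) ∈ (V n : Set (S.Bar O × S.Bar O)) := by
  obtain ⟨m₁, h₁⟩ := exists_lt_gprod_trans S O n
  obtain ⟨m₂, h₂⟩ := exists_lt_gprod_of_dist_lt S O n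
  -- The factor `2` lets two metric steps add up to less than `1/n`, and makes each at most `1`, as
  -- `h₂` requires.
  set m := max (2 * n) (max m₁ m₂) with hm
  have hmn : 2 * n ≤ m := le_max_left _ _
  have hmm : m₁ ≤ m ∧ m₂ ≤ m := ⟨by omega, by omega⟩
  have hn0 : (1 : ℝ) ≤ n := by exact_mod_cast hn
  have hinv : (m : ℝ)⁻¹ ≤ (2 * (n : ℝ))⁻¹ :=
    inv_anti₀ (by linarith) (by exact_mod_cast hmn)
  have hinv1 : (m : ℝ)⁻¹ ≤ 1 := hinv.trans (inv_le_one_of_one_le₀ (by linarith))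
  have c₁ : (m₁ : ℝ≥0∞) ≤ m := by exact_mod_cast hmm.1
  have c₂ : (m₂ : ℝ≥0∞) ≤ m := by exact_mod_cast hmm.2
  refine ⟨m, by omega, fun x y z hxy hyz => ?_⟩
  rcases hxy with hxy | ⟨p, q, hpq, hd⟩ <;> rcases hyz with hyz | ⟨p', q', hpq', hd'⟩
  · exact Or.inl (h₁ x y z (c₁.trans_lt hxy) (c₁.trans_lt hyz))
  · obtain ⟨rfl, rfl⟩ := Prod.mk.inj hpq'
    exact Or.inl (h₂ x p' q' (c₂.trans_lt hxy) (hd'.le.trans hinv1))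
  · obtain ⟨rfl, rfl⟩ := Prod.mk.inj hpq
    left
    change _ < gprod _ _
    rw [gprod_comm]
    rw [dist_comm] at hd
    refine h₂ z q p (c₂.trans_lt ?_) (hd.le.trans hinv1)
    rw [gprod_comm]
    exact hyz
  · obtain ⟨rfl, rfl⟩ := Prod.mk.inj hpq
    obtain ⟨h, rfl⟩ := Prod.mk.inj hpq'
    obtain rfl := point.inj h
    refine Or.inr ⟨p, q', rfl, ?_⟩
    have h3 := dist_triangle p q q'
    rw [mul_inv] at hinv
    linarith

theorem mem_V_self [ProperSpace X] (x : S.Bar O) {n : ℕ} (hn : 1 ≤ n) :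
    (x, x) ∈ (V n : Set (S.Bar O × S.Bar O)) := by
  cases x with
  | point x =>
    refine Or.inr ⟨x, x, rfl, ?_⟩
    rw [dist_self]
    exact inv_pos.2 (by exact_mod_cast hn)
  | ideal ξ =>
    left
    change _ < gprod _ _
    rw [gprod_ideal_self]
    exact ENNReal.natCast_lt_top n

/-- That `Vₙ(x)` is a neighbourhood is not built into the topology. The points `y` with some `Vₘ(y)`
inside `Vₙ(x)` form an open set by the composition property, and it lies in `Vₙ(x)` by reflexivity.
-/
theorem nhds_hasBasis [ProperSpace X] (x : S.Bar O) :
    (𝓝 x).HasBasis (fun n : ℕ => 1 ≤ n) fun n => {y | (x, y) ∈ V n} := by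
  refine ⟨fun s => ⟨fun hs => ?_, ?_⟩⟩
  · obtain ⟨U, hUs, hU, hx⟩ := mem_nhds_iff.1 hs
    obtain ⟨n, hn, h⟩ := hU x hx
    exact ⟨n, hn, h.trans hUs⟩
  · rintro ⟨n, hn, hns⟩
    refine mem_nhds_iff.2 ⟨{y | ∃ m : ℕ, 1 ≤ m ∧ {z | (y, z) ∈ V m} ⊆ {z | (x, z) ∈ V n}},
      ?_, ?_, n, hn, subset_rfl⟩
    · rintro y ⟨m, hm, h⟩
      exact hns (h (mem_V_self y hm))
    · rintro y ⟨m, hm, h⟩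
      obtain ⟨l, hl, hlm⟩ := exists_V_comp_subset S O m hm
      exact ⟨l, hl, fun z hz => ⟨l, hl, fun w hw => h (hlm y z w hz hw)⟩⟩

theorem mem_V_ideal_iff {ξ : S.Boundary} {y : S.Bar O} {n : ℕ} :
    ((ideal ξ : S.Bar O), y) ∈ (V n : Set (S.Bar O × S.Bar O)) ↔
      (n : ℝ≥0∞) < gprod y (ideal ξ) := by
  rw [gprod_comm]
  refine ⟨?_, Or.inl⟩
  rintro (h | ⟨p, q, h, -⟩)
  · exact h
  · exact absurd (Prod.mk.inj h).1 (by simp)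

theorem tendsto_nhds_ideal_iff [ProperSpace X] {α : Type*} {l : Filter α} {u : α → S.Bar O} {ξ : S.Boundary} :
    Tendsto u l (𝓝 (ideal ξ)) ↔ ∀ N : ℕ, ∀ᶠ i in l, (N : ℝ≥0∞) < gprod (u i) (ideal ξ) := by
  rw [(nhds_hasBasis (ideal ξ)).tendsto_right_iff]
  simp only [Set.mem_ofPred_eq, mem_V_ideal_iff]
  refine ⟨fun h N => ?_, fun h N _ => h N⟩
  -- The basis is indexed by `n ≥ 1`; the shift covers `N = 0`.
  filter_upwards [h (N + 1) (by omega)] with i hi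
  refine lt_of_le_of_lt ?_ hi
  exact_mod_cast Nat.le_succ N

/-- The limit of a sequence converging to an ideal point is unique. -/
theorem eq_ideal_of_tendsto [ProperSpace X] {u : ℕ → S.Bar O} {ξ : S.Boundary} {z : S.Bar O}
    (h : Tendsto u atTop (𝓝 (ideal ξ))) (hz : Tendsto u atTop (𝓝 z)) : z = ideal ξ := by
  refine eq_of_forall_lt_gprod fun N => ?_
  obtain ⟨m, hm, hmN⟩ := exists_V_comp_subset S O (N + 1) (by omega)
  have h1 := tendsto_nhds_ideal_iff.1 h m
  have h2 := (nhds_hasBasis z).tendsto_right_iff.1 hz m hm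
  obtain ⟨n, hn1, hn2⟩ := (h1.and h2).exists
  have h3 := hmN z (u n) (ideal ξ) hn2 (Or.inl hn1)
  rcases h3 with h3 | ⟨p, q, h3, -⟩
  · refine lt_of_le_of_lt ?_ h3
    exact_mod_cast Nat.le_succ N
  · exact absurd (Prod.mk.inj h3).2 (by simp)

end Ideal

end Bar

end CoarseConvexity

/-! ### Visual maps and the boundary map -/

open CoarseConvexity CoarseConvexity.Bar in
-- Turns the sequential definition into a uniform one: counterexamples chosen for every `M` would
-- form two sequences violating it.
theorem IsVisual.exists_lt_gprod {X Y : Type*} [MetricSpace X] [MetricSpace Y]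
    {S : CoarseConvexity X} {T : CoarseConvexity Y} {a : X} {b : Y} {f : X → Y}
    (hf : IsVisual S T a b f) (N : ℕ) :
    ∃ M : ℕ, ∀ p q : X, (M : ℝ≥0∞) < gprod (point p : S.Bar a) (point q) →
      (N : ℝ≥0∞) < gprod (point (f p) : T.Bar b) (point (f q)) := by
  by_contra! h
  choose p q h1 h2 using h
  have h3 : Tendsto (fun n => gprod (point (p n) : S.Bar a) (point (q n))) atTop (𝓝 ∞) := by
    refine ENNReal.tendsto_nhds_top fun n => ?_
    filter_upwards [eventually_ge_atTop n] with m hm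
    refine lt_of_le_of_lt ?_ (h1 m)
    exact_mod_cast hm
  obtain ⟨n, hn⟩ := (ENNReal.tendsto_nhds_top_iff_nat.1 (hf.2 p q h3) N).exists
  exact absurd hn (not_lt.2 (h2 n))

open CoarseConvexity CoarseConvexity.Bar in
/-- A visual map has a limit at every ideal point. -/
theorem IsVisual.exists_ideal {X Y : Type*} [MetricSpace X] [ProperSpace X] [MetricSpace Y]
    [ProperSpace Y] {S : CoarseConvexity X} {T : CoarseConvexity Y} {a : X} {b : Y} {f : X → Y}
    (hf : IsVisual S T a b f) (ξ : S.Boundary) :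
    ∃ η : T.Boundary, ∀ N : ℕ, ∃ M : ℕ, ∀ p : X,
      (M : ℝ≥0∞) < gprod (point p : S.Bar a) (ideal ξ) →
        (N : ℝ≥0∞) < gprod (point (f p) : T.Bar b) (ideal η) := by
  obtain ⟨γ, rfl⟩ : ∃ γ, S.cls γ = ξ := Quotient.exists_rep ξ
  -- A Cauchy condition on all points near the ideal point; the ray `γ` only serves to locate the
  -- limit.
  have key : ∀ N : ℕ, ∃ M : ℕ, ∀ p q : X,
      (M : ℝ≥0∞) < gprod (point p : S.Bar a) (ideal (S.cls γ)) →
      (M : ℝ≥0∞) < gprod (point q : S.Bar a) (ideal (S.cls γ)) →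
      (N : ℝ≥0∞) < gprod (point (f p) : T.Bar b) (point (f q)) := by
    intro N
    obtain ⟨m, hm⟩ := hf.exists_lt_gprod N
    obtain ⟨M, hM⟩ := exists_lt_gprod_trans S a m
    refine ⟨M, fun p q hp hq => hm p q (hM _ _ _ hp ?_)⟩
    rwa [gprod_comm]
  obtain ⟨η, hη⟩ := exists_ideal_of_cauchy (S := T) (O := b) (fun n : ℕ => f (γ.1 (n : ℝ≥0)))
    (fun N => by
      obtain ⟨M, hM⟩ := key N
      obtain ⟨m, hm⟩ := exists_lt_gprod_ray a γ M
      exact ⟨m, fun i hi j hj => hM _ _ (hm i hi) (hm j hj)⟩)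
  refine ⟨η, fun N => ?_⟩
  obtain ⟨m, hm⟩ := exists_lt_gprod_trans T b N
  obtain ⟨M, hM⟩ := key m
  obtain ⟨i, hi⟩ := exists_lt_gprod_ray a γ M
  obtain ⟨j, hj⟩ := hη m
  exact ⟨M, fun p hp => hm _ _ _ (hM p _ hp (hi (max i j) (le_max_left _ _)))
    (hj (max i j) (le_max_right _ _))⟩

open CoarseConvexity CoarseConvexity.Bar in
theorem proposition3 {X Y : Type*} [MetricSpace X] [ProperSpace X] [MetricSpace Y] [ProperSpace Y]
    (S : CoarseConvexity X) (T : CoarseConvexity Y) (a : X) (b : Y)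
    (f : X → Y) (hf : IsVisual S T a b f) :
    ∃ F : S.Boundary → T.Boundary,
      (∀ γ : S.Linf,
        Tendsto (fun n : ℕ => (.point (f (γ.1 (n : ℝ≥0))) : T.Bar b)) atTop
          (𝓝 (.ideal (F (S.cls γ)))) ∧
        ∀ z : T.Bar b,
          Tendsto (fun n : ℕ => (.point (f (γ.1 (n : ℝ≥0))) : T.Bar b)) atTop (𝓝 z) →
            z = .ideal (F (S.cls γ))) ∧
      ∀ ξ : S.Boundary, ContinuousAt (combinedMap S T a b f F) (.ideal ξ) := by
  choose F hF using hf.exists_ideal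
  have hray : ∀ γ : S.Linf, Tendsto (fun n : ℕ => (.point (f (γ.1 (n : ℝ≥0))) : T.Bar b)) atTop
      (𝓝 (.ideal (F (S.cls γ)))) := by
    refine fun γ => tendsto_nhds_ideal_iff.2 fun N => ?_
    obtain ⟨M, hM⟩ := hF (S.cls γ) N
    obtain ⟨m, hm⟩ := exists_lt_gprod_ray a γ M
    filter_upwards [eventually_ge_atTop m] with n hn
    exact hM _ (hm n hn)
  refine ⟨F, fun γ => ⟨hray γ, fun z hz => eq_ideal_of_tendsto (hray γ) hz⟩, fun ξ => ?_⟩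
  refine tendsto_nhds_ideal_iff.2 fun N => ?_
  obtain ⟨m, hm⟩ := exists_lt_gprod_trans T b N
  obtain ⟨i, hi⟩ := hF ξ m
  obtain ⟨j, hj⟩ := exists_lt_gprod_trans S a i
  obtain ⟨M₁, hM₁⟩ := hF ξ N
  refine ((nhds_hasBasis (ideal ξ : S.Bar a)).eventually_iff).2
    ⟨max 1 (max j M₁), le_max_left _ _, fun {x} hx => ?_⟩
  rw [Set.mem_ofPred_eq, mem_V_ideal_iff] at hx
  have hx1 : (j : ℝ≥0∞) < gprod x (ideal ξ) :=
    lt_of_le_of_lt (by exact_mod_cast (by omega : j ≤ max 1 (max j M₁))) hx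
  have hx2 : (M₁ : ℝ≥0∞) < gprod x (ideal ξ) :=
    lt_of_le_of_lt (by exact_mod_cast (by omega : M₁ ≤ max 1 (max j M₁))) hx
  cases x with
  | point p => exact hM₁ p hx2
  | ideal ζ =>
    -- A far point of `γ` is close to both `ζ` and `ξ`, so its image is close to both `F ζ` and `F
    -- ξ`.
    obtain ⟨γ, rfl⟩ : ∃ γ, S.cls γ = ζ := Quotient.exists_rep ζ
    have h1 := tendsto_nhds_ideal_iff.1 (hray γ) m
    obtain ⟨r, hr⟩ := exists_lt_gprod_ray a γ j
    obtain ⟨n, hn1, hn2⟩ := (h1.and (eventually_ge_atTop r)).exists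
    refine hm _ (point (f (γ.1 (n : ℝ≥0)))) _ ?_ (hi _ (hj _ _ _ (hr n hn2) hx1))
    rwa [gprod_comm]
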